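/- All graphs are finite and simple. A \emph{hole} of a graph $G$ is a chordless cycle of $G$ of length at least $4$, regarded as a subgraph of $G$; $G$ is \emph{hole-edge-disjoint} if any two distinct holes of $G$ have no edge in common, and \emph{$K_{2,2,2}$-free} if it does not contain the complete tripartite graph $K_{2,2,2}$ as an induced subgraph. The \emph{competition graph} of a digraph $D$ has the same vertex set as $D$, and two distinct vertices $u$ and $v$ are adjacent in it if and only if there is a vertex $x$ such that $(u,x)$ and $(v,x)$ are arcs of $D$. The \emph{competition number} $k(G)$ is the smallest nonnegative integer $k$ such that $G$ together with $k$ added isolated vertices is the competition graph of an acyclic digraph. If $G$ is a $K_{2,2,2}$-free hole-edge-disjoint graph with exactly $h$ holes, then $k(G) \le h+1$. -/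

import Mathlib

namespace CompetitionHoles

/-- A hole of `G`, regarded as a subgraph of `G`: a chordless cycle of length at least `4`.
Cycles that differ only by a rotation or a reversal give the same subgraph. -/
def IsHole {V : Type*} {G : SimpleGraph V} (C : G.Subgraph) : Prop :=
  ∃ (v : V) (p : G.Walk v v), p.IsCycle ∧ 4 ≤ p.length ∧
    (∀ x ∈ p.support, ∀ y ∈ p.support, G.Adj x y → s(x, y) ∈ p.edges) ∧
    p.toSubgraph = C

/-- The set of holes of `G`. -/
def holes {V : Type*} (G : SimpleGraph V) : Set G.Subgraph :=
  {C | IsHole C}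

/-- All the holes of `G` are mutually edge-disjoint. -/
def HoleEdgeDisjoint {V : Type*} (G : SimpleGraph V) : Prop :=
  ∀ C₁ ∈ holes G, ∀ C₂ ∈ holes G, C₁ ≠ C₂ → Disjoint C₁.edgeSet C₂.edgeSet

/-- `G` does not contain the complete tripartite graph `K_{2,2,2}` as an induced subgraph. -/
def K222Free {V : Type*} (G : SimpleGraph V) : Prop :=
  ¬ (SimpleGraph.completeMultipartiteGraph (fun _ : Fin 3 => Fin 2)).IsIndContained G

/-- A digraph is acyclic if it has no directed cycle (in particular no loop). -/
def Acyclic {W : Type*} (D : Digraph W) : Prop :=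
  ∀ w : W, ¬ Relation.TransGen D.Adj w w

/-- The competition graph of a digraph: distinct vertices are adjacent if and only if they have
a common out-neighbour. -/
def competitionGraph {W : Type*} (D : Digraph W) : SimpleGraph W where
  Adj u v := u ≠ v ∧ ∃ x, D.Adj u x ∧ D.Adj v x
  symm := ⟨fun _ _ h => ⟨h.1.symm, h.2.imp fun _ hx => hx.symm⟩⟩
  loopless := ⟨fun _ h => h.1 rfl⟩

/-- `G` together with `k` added isolated vertices is the competition graph of an acyclic
digraph. -/
def IsCompetitionWith {V : Type*} (G : SimpleGraph V) (k : ℕ) : Prop :=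
  ∃ D : Digraph (V ⊕ Fin k), Acyclic D ∧
    competitionGraph D = G.sum (⊥ : SimpleGraph (Fin k))

/-- The competition number of `G`: the smallest `k` such that `G` together with `k` added isolated
vertices is the competition graph of an acyclic digraph (and `⊤` if there is no such `k`). -/
noncomputable def competitionNumber {V : Type*} (G : SimpleGraph V) : ℕ∞ :=
  ⨅ k ∈ {k : ℕ | IsCompetitionWith G k}, (k : ℕ∞)

end CompetitionHoles

/-!
The bound `k(G) ≤ h + 1` is obtained by induction on the number of vertices, removing one
*avoidable* vertex at a time. A vertex `v` is avoidable if any two non-adjacent neighbours `x`, `y`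
of `v` are joined by a walk whose inner vertices lie outside the closed neighbourhood of `v`. Every
nonempty finite graph has such a vertex (`exists_isAvoidable`).

A shortest walk of this kind, closed up through `v`, is a hole that meets the neighbourhood of `v`
exactly in `x` and `y` (`IsAvoidable.exists_isHoleSet`). Choose a neighbour of `v` in every hole
through `v`, and let `T` be the set of chosen vertices. Then `T` has at most as many elements as
there are holes through `v`, and it meets every pair of non-adjacent neighbours of `v`, so the
neighbours of `v` outside `T` form a clique. Hence the edges at `v` are covered by `|T| + 1`
cliques, one for each `t ∈ T` and one for all the other neighbours.

The holes of `G - v` are the holes of `G` that avoid `v`. Given an acyclic digraph for `G - v` and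
its added vertices, put `v` in the place of one added vertex and create `|T| + 1` new added
vertices as the common out-neighbours of these cliques (`HasCompetitionScheme.of_delete`). The
number of added vertices grows by `|T|`, which is at most the number of holes destroyed.
-/

namespace CompetitionHoles

open SimpleGraph

/-! ### Avoidable vertices -/

/-- The vertices outside the closed neighbourhood of `v`. -/
def farSet {V : Type*} (G : SimpleGraph V) (v : V) : Set V :=
  {z | z ≠ v ∧ ¬ G.Adj v z}

/-- A vertex `v` is avoidable if any two non-adjacent neighbours of `v` are joined by a walk with
all its vertices, other than these two, outside the closed neighbourhood of `v`. -/
def IsAvoidable {V : Type*} (G : SimpleGraph V) (v : V) : Prop :=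
  ∀ x y, G.Adj v x → G.Adj v y → x ≠ y → ¬ G.Adj x y →
    ∃ p : G.Walk x y, ∀ z ∈ p.support, z = x ∨ z = y ∨ z ∈ farSet G v

/-- The vertices that can be reached from `d` without meeting the closed neighbourhood of `v`: the
component of `d` in the graph induced on `farSet G v`, or the empty set if `d ∉ farSet G v`. -/
def farComponent {V : Type*} (G : SimpleGraph V) (v d : V) : Set V :=
  {z | ∃ p : G.Walk d z, ∀ w ∈ p.support, w ∈ farSet G v}

section Avoidable

variable {V : Type*} {G : SimpleGraph V}

lemma farComponent_subset_farSet (v d : V) : farComponent G v d ⊆ farSet G v :=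
  fun _ ⟨p, hp⟩ => hp _ p.end_mem_support

lemma mem_farComponent_self {v d : V} (hd : d ∈ farSet G v) : d ∈ farComponent G v d :=
  ⟨.nil, by simpa using hd⟩

lemma mem_farComponent_of_adj {v d z w : V} (hz : z ∈ farComponent G v d) (hzw : G.Adj z w)
    (hw : w ∈ farSet G v) : w ∈ farComponent G v d := by
  obtain ⟨p, hp⟩ := hz
  refine ⟨p.concat hzw, fun u hu => ?_⟩
  rw [Walk.support_concat, List.mem_append, List.mem_singleton] at hu
  rcases hu with hu | rfl
  · exact hp u hu
  · exact hw

lemma support_subset_farComponent {v d z : V} (p : G.Walk d z)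
    (hp : ∀ w ∈ p.support, w ∈ farSet G v) : ∀ w ∈ p.support, w ∈ farComponent G v d := by
  classical
  exact fun w hw => ⟨p.takeUntil w hw,
    fun u hu => hp u (p.support_takeUntil_subset_support hw hu)⟩

/-- Two vertices with neighbours in the same component of `farSet G v` are joined by a walk through
that component. -/
lemma exists_walk_through_farComponent {v d x y x' y' : V} (hx' : x' ∈ farComponent G v d)
    (hy' : y' ∈ farComponent G v d) (hx : G.Adj x x') (hy : G.Adj y y') :
    ∃ p : G.Walk x y, ∀ z ∈ p.support, z = x ∨ z = y ∨ z ∈ farSet G v := by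
  obtain ⟨p, hp⟩ := hx'
  obtain ⟨q, hq⟩ := hy'
  refine ⟨.cons hx ((p.reverse.append q).concat hy.symm), fun z hz => ?_⟩
  simp only [Walk.support_cons, Walk.support_concat, List.mem_cons, List.mem_append,
    Walk.mem_support_append_iff, Walk.support_reverse, List.mem_reverse,
    List.not_mem_nil, or_false] at hz
  rcases hz with h | (h | h) | h
  · exact .inl h
  · exact .inr (.inr (hp z h))
  · exact .inr (.inr (hq z h))
  · exact .inr (.inl h)

/-- Every nonempty finite graph has an avoidable vertex. Take a vertex `v` and a component `D` of
`farSet G v` with `|D|` maximal, and let `A` be the set of vertices outside `D` without neighbours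
in `D`. By maximality `D` is a component of `farSet G a` for every `a ∈ A`, so every `a ∈ A` is
adjacent to all vertices of the boundary of `D`. Therefore an avoidable vertex of the smaller graph
induced on `A` is avoidable in `G`. -/
theorem exists_isAvoidable {V : Type*} [Finite V] [Nonempty V] (G : SimpleGraph V) :
    ∃ v, IsAvoidable G v := by
  induction hn : Nat.card V using Nat.strong_induction_on generalizing V with
  | _ n ih =>
  by_cases hfar : ∃ v d, d ∈ farSet G v
  swap
  · -- `G` is complete, so there is nothing to join.
    obtain ⟨v⟩ := ‹Nonempty V›
    refine ⟨v, fun x y _ _ hxy hnadj => ?_⟩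
    exact absurd ⟨x, y, hxy.symm, hnadj⟩ hfar
  obtain ⟨v₀, d₀, h₀⟩ := hfar
  have : Nonempty {q : V × V // q.2 ∈ farSet G q.1} := ⟨⟨(v₀, d₀), h₀⟩⟩
  obtain ⟨⟨⟨v, d⟩, hd⟩, hmax⟩ := Finite.exists_max
    (fun q : {q : V × V // q.2 ∈ farSet G q.1} => (farComponent G q.1.1 q.1.2).ncard)
  set D := farComponent G v d
  let A : Set V := {a | a ∉ D ∧ ∀ z ∈ D, ¬ G.Adj a z}
  have hdD : d ∈ D := mem_farComponent_self hd
  have hvA : v ∈ A := ⟨fun h => (farComponent_subset_farSet v d h).1 rfl,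
    fun z hz => (farComponent_subset_farSet v d hz).2⟩
  have hfarA : ∀ a ∈ A, D ⊆ farSet G a := fun a ha z hz =>
    ⟨fun h => ha.1 (h ▸ hz), ha.2 z hz⟩
  have hDa : ∀ a ∈ A, farComponent G a d = D := by
    intro a ha
    refine (Set.eq_of_subset_of_ncard_le ?_ (hmax ⟨(a, d), hfarA a ha hdD⟩)
      (Set.toFinite _)).symm
    rintro z ⟨p, hp⟩
    exact ⟨p, fun w hw => hfarA a ha (support_subset_farComponent p hp w hw)⟩
  have hboundary : ∀ a ∈ A, ∀ s ∉ D, ∀ z ∈ D, G.Adj s z → G.Adj a s := by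
    intro a ha s hs z hz hsz
    by_contra hnadj
    refine hs (hDa a ha ▸ mem_farComponent_of_adj ((hDa a ha).symm ▸ hz) hsz.symm ⟨?_, hnadj⟩)
    rintro rfl
    exact ha.2 z hz hsz
  have hcard : Nat.card A < n := by
    rw [← hn]
    exact Set.ncard_lt_card (s := A) fun h => (h ▸ Set.mem_univ d : d ∈ A).1 hdD
  have : Nonempty A := ⟨⟨v, hvA⟩⟩
  obtain ⟨⟨a, ha⟩, hav⟩ := ih _ hcard (G.induce A) rfl
  refine ⟨a, fun x y hx hy hxy hnadj => ?_⟩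
  have hnD : ∀ x, G.Adj a x → x ∉ D := fun x hx h => ha.2 x h hx
  by_cases hxA : x ∈ A <;> by_cases hyA : y ∈ A
  · obtain ⟨p, hp⟩ := hav ⟨x, hxA⟩ ⟨y, hyA⟩ hx hy (by simpa using hxy) hnadj
    refine ⟨p.map (Embedding.induce A).toHom, fun z hz => ?_⟩
    replace hz : z ∈ (p.map (Embedding.induce A).toHom).support := hz
    rw [Walk.support_map, List.mem_map] at hz
    obtain ⟨w, hw, rfl⟩ := hz
    rcases hp w hw with rfl | rfl | h
    · exact .inl rfl
    · exact .inr (.inl rfl)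
    · exact .inr (.inr ⟨fun e => h.1 (Subtype.ext e), h.2⟩)
  · have : ∃ z ∈ D, G.Adj y z := by
      by_contra! h
      exact hyA ⟨hnD y hy, h⟩
    obtain ⟨z, hz, hyz⟩ := this
    exact absurd (hboundary x hxA y (hnD y hy) z hz hyz) hnadj
  · have : ∃ z ∈ D, G.Adj x z := by
      by_contra! h
      exact hxA ⟨hnD x hx, h⟩
    obtain ⟨z, hz, hxz⟩ := this
    exact absurd (hboundary y hyA x (hnD x hx) z hz hxz).symm hnadj
  · have hx' : ∃ z ∈ D, G.Adj x z := by
      by_contra! h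
      exact hxA ⟨hnD x hx, h⟩
    have hy' : ∃ z ∈ D, G.Adj y z := by
      by_contra! h
      exact hyA ⟨hnD y hy, h⟩
    obtain ⟨x', hx'D, hxx'⟩ := hx'
    obtain ⟨y', hy'D, hyy'⟩ := hy'
    rw [← hDa a ha] at hx'D hy'D
    exact exists_walk_through_farComponent hx'D hy'D hxx' hyy'

end Avoidable

/-! ### Holes as vertex sets -/

/-- The vertex set of a hole of `G`. Counting vertex sets instead of
subgraphs makes it easy to pass to induced subgraphs, and `ncard_isHoleSet_le` suffices for an upper
bound in terms of holes. -/
def IsHoleSet {V : Type*} (G : SimpleGraph V) (S : Set V) : Prop :=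
  ∃ C ∈ holes G, C.verts = S

section HoleSet

variable {V : Type*} {G : SimpleGraph V}

lemma ncard_isHoleSet_le (h : (holes G).Finite) : {S | IsHoleSet G S}.ncard ≤ (holes G).ncard :=
  Set.ncard_image_le h

/-- The holes of an induced subgraph are holes of the whole graph. -/
lemma IsHoleSet.of_induce {A : Set V} {S : Set A} (h : IsHoleSet (G.induce A) S) :
    IsHoleSet G (Subtype.val '' S) := by
  obtain ⟨_, ⟨v, p, hp, hlen, hchord, rfl⟩, rfl⟩ := h
  have hinj : Function.Injective (Embedding.induce (G := G) A).toHom := Subtype.val_injective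
  refine ⟨_, ⟨_, p.map (Embedding.induce A).toHom, hp.map hinj,
    hlen.trans_eq (Walk.length_map ..).symm, ?_, rfl⟩, ?_⟩
  · intro x hx y hy hxy
    rw [Walk.support_map, List.mem_map] at hx hy
    obtain ⟨x, hx, rfl⟩ := hx
    obtain ⟨y, hy, rfl⟩ := hy
    rw [Walk.edges_map, List.mem_map]
    exact ⟨s(x, y), hchord x hx y hy hxy, rfl⟩
  · ext z
    simp only [Walk.verts_toSubgraph, Walk.support_map, List.mem_map, Set.mem_ofPred_eq,
      Set.mem_image]
    rfl

/-- A walk inside `W` of minimal length among all such walks is a chordless path. -/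
lemma isPath_and_isChordless_of_minimal {W : Set V} {x y : V} (p : G.Walk x y)
    (hpW : ∀ z ∈ p.support, z ∈ W)
    (hmin : ∀ q : G.Walk x y, (∀ z ∈ q.support, z ∈ W) → p.length ≤ q.length) :
    p.IsPath ∧ p.IsChordless := by
  classical
  refine ⟨?_, ?_⟩
  · rw [← p.bypass_eq_self_of_length_le_length_bypass
      (hmin _ fun z hz => hpW z (p.support_bypass_subset_support hz))]
    exact p.bypass_isPath
  · have key : ∀ i j, i ≤ j → j ≤ p.length → G.Adj (p.getVert i) (p.getVert j) →
        s(p.getVert i, p.getVert j) ∈ p.edges := by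
      intro i j hij hj hadj
      -- The chord gives the shortcut `q`; by minimality it does not skip any vertex of `p`.
      let q : G.Walk x y := (p.take i).append (.cons hadj (p.drop j))
      have hq : p.length ≤ q.length := by
        refine hmin q fun z hz => ?_
        rw [Walk.mem_support_append_iff, Walk.support_cons, List.mem_cons] at hz
        rcases hz with hz | rfl | hz
        · exact hpW z ((p.isSubwalk_take i).support_subset hz)
        · exact hpW _ (p.getVert_mem_support i)
        · exact hpW z ((p.isSubwalk_drop j).support_subset hz)
      have hlen : q.length = min i p.length + (p.length - j + 1) := by
        simp [q, Walk.length_append, Walk.take_length, Walk.drop_length]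
      have hne : i ≠ j := by
        rintro rfl
        exact hadj.ne rfl
      obtain rfl : j = i + 1 := by omega
      exact p.mk_mem_edges_iff_exists.mpr ⟨i, by omega, rfl⟩
    rw [Walk.isChordless_iff_forall_mem_edges]
    intro a b ha hb hab
    obtain ⟨i, rfl, hi⟩ := Walk.mem_support_iff_exists_getVert.mp ha
    obtain ⟨j, rfl, hj⟩ := Walk.mem_support_iff_exists_getVert.mp hb
    rcases le_total i j with h | h
    · exact key i j h hj hab
    · rw [Sym2.eq_swap]
      exact key j i h hi hab.symm

/-- Through an avoidable vertex `v` and any two non-adjacent neighbours of `v` there is a hole,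
which contains no further neighbour of `v`. -/
lemma IsAvoidable.exists_isHoleSet {v x y : V} (hv : IsAvoidable G v) (hx : G.Adj v x)
    (hy : G.Adj v y) (hxy : x ≠ y) (hnadj : ¬ G.Adj x y) :
    ∃ S, IsHoleSet G S ∧ v ∈ S ∧ x ∈ S ∧ ∀ z ∈ S, G.Adj v z → z = x ∨ z = y := by
  let W : Set V := {z | z = x ∨ z = y ∨ z ∈ farSet G v}
  have hex : ∃ n, ∃ p : G.Walk x y, (∀ z ∈ p.support, z ∈ W) ∧ p.length = n := by
    obtain ⟨p, hp⟩ := hv x y hx hy hxy hnadj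
    exact ⟨_, p, hp, rfl⟩
  classical
  obtain ⟨p, hpW, hlen⟩ := Nat.find_spec hex
  have hmin : ∀ q : G.Walk x y, (∀ z ∈ q.support, z ∈ W) → p.length ≤ q.length :=
    fun q hq => hlen ▸ Nat.find_min' hex ⟨q, hq, rfl⟩
  obtain ⟨hpath, hchord⟩ := isPath_and_isChordless_of_minimal p hpW hmin
  have hvp : v ∉ p.support := fun h => by
    rcases hpW v h with h | h | h
    · exact hx.ne h
    · exact hy.ne h
    · exact h.1 rfl
  have hnbr : ∀ z ∈ p.support, G.Adj v z → z = x ∨ z = y := fun z hz hvz => by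
    rcases hpW z hz with h | h | h
    · exact .inl h
    · exact .inr h
    · exact absurd hvz h.2
  have hplen : 2 ≤ p.length := by
    by_contra! h
    interval_cases hl : p.length
    · exact hxy (Walk.eq_of_length_eq_zero hl)
    · exact hnadj (Walk.adj_of_length_eq_one hl)
  let q : G.Walk v v := .cons hx (p.concat hy.symm)
  have hsupp : ∀ z, z ∈ q.support ↔ z = v ∨ z ∈ p.support := by
    intro z
    simp only [q, Walk.support_cons, Walk.support_concat, List.mem_cons, List.mem_append,
      List.not_mem_nil, or_false]
    tauto
  have hedges : ∀ e, e ∈ q.edges ↔ e = s(v, x) ∨ e ∈ p.edges ∨ e = s(y, v) := by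
    intro e
    simp [q, Walk.edges_concat]
  have hvedge : ∀ z ∈ p.support, G.Adj v z → s(v, z) ∈ q.edges := by
    intro z hz hvz
    rw [hedges]
    rcases hnbr z hz hvz with rfl | rfl
    · exact .inl rfl
    · exact .inr (.inr Sym2.eq_swap)
  refine ⟨q.toSubgraph.verts, ⟨_, ⟨v, q, ?_, ?_, ?_, rfl⟩, rfl⟩, ?_, ?_, ?_⟩
  · rw [Walk.cons_isCycle_iff]
    refine ⟨hpath.concat hvp _, fun h => ?_⟩
    rw [Walk.edges_concat, List.concat_eq_append, List.mem_append, List.mem_singleton] at h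
    rcases h with h | h
    · exact hvp (p.fst_mem_support_of_mem_edges h)
    · rw [Sym2.eq_iff] at h
      rcases h with ⟨h, -⟩ | ⟨-, h⟩
      · exact hy.ne h
      · exact hxy h
  · simp only [q, Walk.length_cons, Walk.length_concat]
    omega
  · intro a ha b hb hab
    rw [hsupp] at ha hb
    rcases ha with rfl | ha <;> rcases hb with rfl | hb
    · exact absurd rfl hab.ne
    · exact hvedge b hb hab
    · rw [Sym2.eq_swap]
      exact hvedge a ha hab.symm
    · exact (hedges _).mpr (.inr (.inl (hchord.mem_edges ha hb hab)))
  · simp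
  · rw [Walk.mem_verts_toSubgraph, hsupp]
    exact .inr p.start_mem_support
  · intro z hz hvz
    rw [Walk.mem_verts_toSubgraph, hsupp] at hz
    exact hnbr z (hz.resolve_left hvz.ne') hvz

/-- The neighbours of an avoidable vertex `v` form a clique after the removal of a set `T` that has
at most as many elements as there are holes through `v`. -/
lemma IsAvoidable.exists_ncard_le [Finite V] {v : V} (hv : IsAvoidable G v) :
    ∃ T : Set V, T.ncard ≤ {S | IsHoleSet G S ∧ v ∈ S}.ncard ∧ T ⊆ G.neighborSet v ∧
      ∀ x y, G.Adj v x → G.Adj v y → x ∉ T → y ∉ T → x ≠ y → G.Adj x y := by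
  -- `f S` is a neighbour of `v` in `S`, and the junk value `v` if there is none.
  have hf : ∀ S : Set V, ∃ z, (∃ z ∈ S, G.Adj v z) → z ∈ S ∧ G.Adj v z := by
    intro S
    by_cases h : ∃ z ∈ S, G.Adj v z
    · obtain ⟨z, hz⟩ := h
      exact ⟨z, fun _ => hz⟩
    · exact ⟨v, fun h' => absurd h' h⟩
  choose f hf using hf
  refine ⟨f '' {S | IsHoleSet G S ∧ v ∈ S} ∩ G.neighborSet v,
    (Set.ncard_le_ncard Set.inter_subset_left (Set.toFinite _)).trans
      (Set.ncard_image_le (Set.toFinite _)), Set.inter_subset_right, ?_⟩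
  intro x y hx hy hxT hyT hxy
  by_contra hnadj
  obtain ⟨S, hS, hvS, hxS, hmem⟩ := hv.exists_isHoleSet hx hy hxy hnadj
  obtain ⟨hfS, hfadj⟩ := hf S ⟨x, hxS, hx⟩
  have hfT : f S ∈ f '' {S | IsHoleSet G S ∧ v ∈ S} ∩ G.neighborSet v :=
    ⟨⟨S, ⟨hS, hvS⟩, rfl⟩, hfadj⟩
  rcases hmem _ hfS hfadj with h | h
  · exact hxT (h ▸ hfT)
  · exact hyT (h ▸ hfT)

/-- Deleting a vertex destroys the holes through it. -/
lemma ncard_isHoleSet_delete_add_le [Finite V] (v : V) :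
    {S | IsHoleSet (G.induce {v}ᶜ) S}.ncard + {S | IsHoleSet G S ∧ v ∈ S}.ncard ≤
      {S | IsHoleSet G S}.ncard := by
  have hinj := (Subtype.val_injective (p := (· ∈ ({v}ᶜ : Set V)))).image_injective
  rw [← Set.ncard_image_of_injective _ hinj,
    ← Set.ncard_union_eq _ (Set.toFinite _) (Set.toFinite _)]
  · refine Set.ncard_le_ncard ?_ (Set.toFinite _)
    rintro _ (⟨S, hS, rfl⟩ | hS)
    · exact IsHoleSet.of_induce hS
    · exact hS.1
  · rw [Set.disjoint_left]
    rintro _ ⟨S, -, rfl⟩ ⟨-, ⟨w, hw⟩, -, hwv⟩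
    exact hw hwv

end HoleSet

/-! ### Acyclic digraphs with added vertices -/

/-- An acyclic digraph on `V ⊕ K` whose competition graph is `G` with the isolated vertices `K`
added, in which no arc leaves `K`. The arcs are given by `R`, and acyclicity is witnessed by a rank
on `V` that decreases along arcs. -/
def HasCompetitionScheme {V : Type*} (G : SimpleGraph V) (K : Type*) : Prop :=
  ∃ (R : V → V ⊕ K → Prop) (r : V → ℕ), (∀ u w, R u (.inl w) → r w < r u) ∧
    ∀ u w, u ≠ w → (G.Adj u w ↔ ∃ t, R u t ∧ R w t)

section Scheme

variable {V : Type*} {G : SimpleGraph V}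

lemma HasCompetitionScheme.map {K K' : Type*} (h : HasCompetitionScheme G K) (f : K ↪ K') :
    HasCompetitionScheme G K' := by
  obtain ⟨R, r, hr, hG⟩ := h
  refine ⟨fun u t => ∃ s, R u s ∧ Sum.map id f s = t, r, ?_, fun u w huw => ?_⟩
  · rintro u w ⟨s | s, hs, hsw⟩
    · obtain rfl : s = w := by simpa using hsw
      exact hr u s hs
    · simp at hsw
  · rw [hG u w huw]
    constructor
    · rintro ⟨t, hu, hw⟩
      exact ⟨_, ⟨t, hu, rfl⟩, ⟨t, hw, rfl⟩⟩
    · rintro ⟨_, ⟨t, hu, rfl⟩, ⟨s, hw, hst⟩⟩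
      obtain rfl := Function.Injective.sumMap Function.injective_id f.injective hst
      exact ⟨s, hu, hw⟩

lemma HasCompetitionScheme.of_card_le {K K' : Type*} [Finite K] [Finite K']
    (h : HasCompetitionScheme G K) (hc : Nat.card K ≤ Nat.card K') :
    HasCompetitionScheme G K' := by
  have := Fintype.ofFinite K
  have := Fintype.ofFinite K'
  rw [Nat.card_eq_fintype_card, Nat.card_eq_fintype_card] at hc
  obtain ⟨f⟩ := Function.Embedding.nonempty_of_card_le hc
  exact h.map f

lemma HasCompetitionScheme.isCompetitionWith {k : ℕ} (h : HasCompetitionScheme G (Fin k)) :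
    IsCompetitionWith G k := by
  obtain ⟨R, r, hr, hG⟩ := h
  let D : Digraph (V ⊕ Fin k) := ⟨fun a b => Sum.elim (fun u => R u b) (fun _ => False) a⟩
  refine ⟨D, fun w hw => ?_, ?_⟩
  · have hrank : ∀ a b, D.Adj a b →
        Sum.elim (fun u => r u + 1) (fun _ => 0) b <
          Sum.elim (fun u => r u + 1) (fun _ => 0) a := by
      rintro (u | i) (w | j) h
      · simpa using hr u w h
      · simp
      · exact h.elim
      · exact h.elim
    have hlt : ∀ a b, Relation.TransGen D.Adj a b →
        Sum.elim (fun u => r u + 1) (fun _ => 0) b <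
          Sum.elim (fun u => r u + 1) (fun _ => 0) a := by
      intro a b h
      induction h with
      | single h => exact hrank _ _ h
      | tail _ h ih => exact (hrank _ _ h).trans ih
    exact lt_irrefl _ (hlt w w hw)
  · ext (u | i) (w | j)
    · rw [sum_adj]
      constructor
      · rintro ⟨hne, t, hu, hw⟩
        exact (hG u w fun h => hne (h ▸ rfl)).mpr ⟨t, hu, hw⟩
      · intro h
        have h' : G.Adj u w := h
        exact ⟨fun e => h'.ne (Sum.inl_injective e), (hG u w h'.ne).mp h'⟩
    · exact ⟨fun ⟨_, _, _, h⟩ => h.elim, fun h => by simp at h⟩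
    · exact ⟨fun ⟨_, _, h, _⟩ => h.elim, fun h => by simp at h⟩
    · exact ⟨fun ⟨_, _, h, _⟩ => h.elim, fun h => by simp at h⟩

/-- Let `T` be a set of neighbours of `v` such that the other neighbours of `v` form a clique. In a
scheme for `G - v`, the vertex `v` replaces one added vertex. The edges at `v` are then produced by
new added vertices: one for every `t ∈ T`, with in-neighbours `v` and `t`, and one with
in-neighbours `v` and all its neighbours outside `T`. -/
lemma HasCompetitionScheme.of_delete {K : Type*} {v : V} {T : Set V}
    (h : HasCompetitionScheme (G.induce {v}ᶜ) (Option K)) (hT : T ⊆ G.neighborSet v)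
    (hclique : ∀ x y, G.Adj v x → G.Adj v y → x ∉ T → y ∉ T → x ≠ y → G.Adj x y) :
    HasCompetitionScheme G (K ⊕ Option T) := by
  classical
  obtain ⟨R, r, hr, hG⟩ := h
  -- The vertex of the new digraph that a vertex of the old digraph becomes.
  let g : ({v}ᶜ : Set V) ⊕ Option K → V ⊕ (K ⊕ Option T) := fun t =>
    match t with
    | .inl w => .inl w
    | .inr none => .inl v
    | .inr (some k) => .inr (.inl k)
  have hg : Function.Injective g := by
    rintro (⟨a, ha⟩ | _ | a) (⟨b, hb⟩ | _ | b) hab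
    · obtain rfl : a = b := by simpa [g] using hab
      rfl
    · exact absurd (by simpa [g] using hab) ha
    · simp [g] at hab
    · exact absurd (by simpa [g] using hab.symm) hb
    · rfl
    · simp [g] at hab
    · simp [g] at hab
    · simp [g] at hab
    · obtain rfl : a = b := by simpa [g] using hab
      rfl
  have hgn : ∀ t o, g t ≠ .inr (.inr o) := by
    rintro (a | _ | a) o h <;> simp [g] at h
  -- The in-neighbours of the new added vertices.
  let N : V → Option T → Prop := fun u o =>
    u = v ∨ match o with
      | none => G.Adj v u ∧ u ∉ T
      | some t => u = t
  refine ⟨fun u t => (∃ (hu : u ∈ ({v}ᶜ : Set V)) (s : _), R ⟨u, hu⟩ s ∧ g s = t) ∨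
      ∃ o, N u o ∧ .inr (.inr o) = t,
    fun u => if hu : u ∈ ({v}ᶜ : Set V) then r ⟨u, hu⟩ + 1 else 0, ?_, ?_⟩
  · rintro u w (⟨hu, s, hs, hsw⟩ | ⟨o, -, ho⟩)
    · rcases s with ⟨s, hsv⟩ | _ | s
      · obtain rfl : s = w := by simpa [g] using hsw
        simpa only [dif_pos hu, dif_pos hsv, add_lt_add_iff_right] using hr _ _ hs
      · obtain rfl : v = w := by simpa [g] using hsw
        have hv : v ∉ ({v}ᶜ : Set V) := fun h => h rfl
        simp only [dif_pos hu, dif_neg hv]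
        exact Nat.succ_pos _
      · simp [g] at hsw
    · simp at ho
  · -- The two ways in which an edge of `G` can be produced.
    have hstep : ∀ u w, (∃ t, ((∃ (hu : u ∈ ({v}ᶜ : Set V)) (s : _), R ⟨u, hu⟩ s ∧ g s = t) ∨
          ∃ o, N u o ∧ .inr (.inr o) = t) ∧
        ((∃ (hw : w ∈ ({v}ᶜ : Set V)) (s : _), R ⟨w, hw⟩ s ∧ g s = t) ∨
          ∃ o, N w o ∧ .inr (.inr o) = t)) ↔
        (∃ (hu : u ∈ ({v}ᶜ : Set V)) (hw : w ∈ ({v}ᶜ : Set V)) (s : _),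
            R ⟨u, hu⟩ s ∧ R ⟨w, hw⟩ s) ∨
          ∃ o, N u o ∧ N w o := by
      intro u w
      constructor
      · rintro ⟨t, ⟨hu, s, hs, hst⟩ | ⟨o, ho, hot⟩, ⟨hw, s', hs', hst'⟩ | ⟨o', ho', hot'⟩⟩
        · obtain rfl := hg (hst.trans hst'.symm)
          exact .inl ⟨hu, hw, s, hs, hs'⟩
        · exact absurd (hst.trans hot'.symm) (hgn s o')
        · exact absurd (hst'.trans hot.symm) (hgn s' o)
        · obtain rfl : o = o' := by simpa using hot.trans hot'.symm
          exact .inr ⟨o, ho, ho'⟩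
      · rintro (⟨hu, hw, s, hs, hs'⟩ | ⟨o, ho, ho'⟩)
        · exact ⟨g s, .inl ⟨hu, s, hs, rfl⟩, .inl ⟨hw, s, hs', rfl⟩⟩
        · exact ⟨_, .inr ⟨o, ho, rfl⟩, .inr ⟨o, ho', rfl⟩⟩
    have hvN : ∀ w, G.Adj v w → ∃ o, N v o ∧ N w o := by
      intro w hvw
      by_cases hw : w ∈ T
      · exact ⟨some ⟨w, hw⟩, .inl rfl, .inr rfl⟩
      · exact ⟨none, .inl rfl, .inr ⟨hvw, hw⟩⟩
    have hNadj : ∀ w o, N w o → w ≠ v → G.Adj v w := by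
      rintro w (_ | t) (h | h) hwv
      · exact absurd h hwv
      · exact h.1
      · exact absurd h hwv
      · obtain rfl : w = t := h
        exact hT t.2
    intro u w huw
    rw [hstep]
    by_cases hu : u = v
    · subst hu
      exact ⟨fun h => .inr (hvN w h), fun h => by
        rcases h with ⟨hu, -⟩ | ⟨o, -, ho⟩
        · exact absurd rfl hu
        · exact hNadj w o ho huw.symm⟩
    by_cases hw : w = v
    · subst hw
      refine ⟨fun h => ?_, fun h => ?_⟩
      · obtain ⟨o, ho, ho'⟩ := hvN u h.symm
        exact .inr ⟨o, ho', ho⟩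
      · rcases h with ⟨-, hw, -⟩ | ⟨o, ho, -⟩
        · exact absurd rfl hw
        · exact (hNadj u o ho huw).symm
    have hG' := hG ⟨u, hu⟩ ⟨w, hw⟩ fun h => huw (congrArg Subtype.val h)
    constructor
    · intro h
      exact .inl ⟨hu, hw, hG'.mp h⟩
    · rintro (⟨_, _, hs⟩ | ⟨_ | t, ho, ho'⟩)
      · exact hG'.mpr hs
      · obtain ⟨hvu, huT⟩ := ho.resolve_left hu
        obtain ⟨hvw, hwT⟩ := ho'.resolve_left hw
        exact hclique u w hvu hvw huT hwT huw
      · have hut : u = t := ho.resolve_left hu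
        have hwt : w = t := ho'.resolve_left hw
        exact absurd (hut.trans hwt.symm) huw

/-- A finite graph with `h` holes needs at most `h + 1` added vertices. -/
theorem hasCompetitionScheme_ncard_isHoleSet {V : Type*} [Finite V] (G : SimpleGraph V) :
    HasCompetitionScheme G (Fin ({S | IsHoleSet G S}.ncard + 1)) := by
  induction hn : Nat.card V using Nat.strong_induction_on generalizing V with
  | _ n ih =>
  rcases isEmpty_or_nonempty V with hV | hV
  · exact ⟨fun _ _ => False, fun _ => 0, fun u => hV.elim u, fun u => hV.elim u⟩
  obtain ⟨v, hv⟩ := exists_isAvoidable G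
  obtain ⟨T, hTcard, hT, hclique⟩ := hv.exists_ncard_le
  have hcard : Nat.card ({v}ᶜ : Set V) < n := by
    rw [← hn]
    exact Set.ncard_lt_card (s := ({v}ᶜ : Set V)) fun h =>
      (h ▸ Set.mem_univ v : v ∈ ({v}ᶜ : Set V)) rfl
  have hdel := (ih _ hcard (G.induce {v}ᶜ) rfl).of_card_le
    (K' := Option (Fin {S | IsHoleSet (G.induce {v}ᶜ) S}.ncard)) (by simp)
  refine (hdel.of_delete hT hclique).of_card_le ?_
  have hle := ncard_isHoleSet_delete_add_le (G := G) v
  rw [Nat.card_sum, Finite.card_option, Nat.card_fin, Nat.card_fin, Nat.card_coe_set_eq]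
  omega

end Scheme

end CompetitionHoles

theorem mainTheorem3 {V : Type*} [Finite V] (G : SimpleGraph V) (h : ℕ)
    (hfree : CompetitionHoles.K222Free G)
    (hdisj : CompetitionHoles.HoleEdgeDisjoint G)
    (hholes : (CompetitionHoles.holes G).encard = h) :
    CompetitionHoles.competitionNumber G ≤ h + 1 := by
  have hfin : (CompetitionHoles.holes G).Finite := Set.finite_of_encard_eq_coe hholes
  have hle : {S | CompetitionHoles.IsHoleSet G S}.ncard ≤ h :=
    (CompetitionHoles.ncard_isHoleSet_le hfin).trans_eq (by simp [Set.ncard, hholes])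
  have hk : CompetitionHoles.IsCompetitionWith G (h + 1) :=
    ((CompetitionHoles.hasCompetitionScheme_ncard_isHoleSet G).of_card_le
      (by simpa using hle)).isCompetitionWith
  exact_mod_cast iInf₂_le (f := fun (k : ℕ)
    (_ : k ∈ {k | CompetitionHoles.IsCompetitionWith G k}) => (k : ℕ∞)) (h + 1) hk
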